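/- Let $m\ge 1$ and $n=2m+1$. Put $r_n=\sec(\pi/n)$ and $\sigma_n=\frac{1}{1+r_n}$. The odd polygon state space $\mathcal S_n\subset\mathbb R^3$ is the convex hull of the points $s_k=\big(r_n\cos\frac{2k\pi}{n},\,r_n\sin\frac{2k\pi}{n},\,1\big)^T$, $k=1,\dots,n$. An effect is a linear functional on $\mathbb R^3$ with values in $[0,1]$ on $\mathcal S_n$, identified with a vector $e\in\mathbb R^3$ through $e(s)=e\cdot s$. An observable $\mathsf A$ with finite outcome set $\Omega$ is a family $(\mathsf A_x)_{x\in\Omega}$ of effects with $\sum_x\mathsf A_x(s)=1$ for all $s\in\mathcal S_n$. An observable $\mathsf B$ is a post-processing of $\mathsf J$ if $\mathsf B_y=\sum_x\nu_{xy}\mathsf J_x$ for all $y$, for some matrix $\nu$ with $0\le\nu_{xy}\le1$ and $\sum_y\nu_{xy}=1$ for every $x$; two observables are compatible if both are post-processings of one common observable; and $\mathcal T_3$ is the set of observables that are compatible with every observable on $\mathcal S_n$. For $\vec a=(a_1,a_2)\in\mathbb R^2$ let $$\eta^n_e(\vec a)=\max_{1\le k\le n} r_n\Big[\cos\tfrac{2\pi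 k}{n}\,a_1+\sin\tfrac{2\pi k}{n}\,a_2\Big],\qquad \eta^n_o(\vec a)=\max_{1\le k\le n} r_n\Big[\cos\tfrac{(2k-1)\pi}{n}\,a_1+\sin\tfrac{(2k-1)\pi}{n}\,a_2\Big].$$ Let $\mathsf A$ be an observable on $\mathcal S_n$ with outcome set $\Omega$ and with effects $\mathsf A_x=\alpha_x(\vec a_x,\sigma_n)^T$, where $\alpha_x\in\mathbb R$ and $\vec a_x\in\mathbb R^2$, for all $x\in\Omega$. If $m$ is even, then $\mathsf A\in\mathcal T_3$ if and only if $$\eta^n_e(\vec a_x)\le\sigma_n r_n\sin\Big(\frac{\pi}{2n}\Big)\qquad\text{for all }x\in\Omega\text{ with }\alpha_x\neq0.$$ If $m$ is odd, then $\mathsf A\in\mathcal T_3$ if and only if $$\eta^n_o(\vec a_x)\le\sigma_n r_n\sin\Big(\frac{\pi}{2n}\Big)\qquad\text{for all }x\in\Omega\text{ with }\alpha_x\neq0.$$ -/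

import Mathlib

noncomputable section

namespace GPT

variable {V : Type*} [AddCommGroup V] [Module ℝ V]

/-- The effects on a state space `S ⊆ V`: linear functionals on the ambient space with values in
`[0, 1]` on all states. -/
def effects (S : Set V) : Set (Module.Dual ℝ V) :=
  {e | ∀ s ∈ S, 0 ≤ e s ∧ e s ≤ 1}

/-- An observable on `S` with finite outcome set `Ω`: a family of effects that sums to the unit
effect, i.e. to the effect that takes the value `1` on every state. -/
structure Observable (S : Set V) (Ω : Type*) [Fintype Ω] where
  effect : Ω → Module.Dual ℝ V
  mem_effects : ∀ x, effect x ∈ effects S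
  sum_eq_one : ∀ s ∈ S, ∑ x, effect x s = 1

/-- `PostProcesses A B`, in symbols `A → B`: the observable `B` is a post-processing of `A` by some
right-stochastic matrix `ν`. -/
def PostProcesses {S : Set V} {Ω Ω' : Type*} [Fintype Ω] [Fintype Ω']
    (A : Observable S Ω) (B : Observable S Ω') : Prop :=
  ∃ ν : Ω → Ω' → ℝ,
    (∀ x y, 0 ≤ ν x y ∧ ν x y ≤ 1) ∧
    (∀ x, ∑ y, ν x y = 1) ∧
    ∀ y, ∀ s ∈ S, B.effect y s = ∑ x, ν x y * A.effect x s

/-- Two observables are compatible if both are post-processings of one observable.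
(Every finite outcome set is in bijection with one in `Type`.) -/
def Compatible {S : Set V} {Ω Ω' : Type*} [Fintype Ω] [Fintype Ω']
    (A : Observable S Ω) (B : Observable S Ω') : Prop :=
  ∃ (Λ : Type) (_ : Fintype Λ) (J : Observable S Λ), PostProcesses J A ∧ PostProcesses J B

/-- The observables (with outcome set `Ω`) that are compatible with every observable on `S`. -/
def T3 (S : Set V) (Ω : Type*) [Fintype Ω] : Set (Observable S Ω) :=
  {A | ∀ (Ω' : Type) [Fintype Ω'] (B : Observable S Ω'), Compatible A B}

/-- `r_n = sec (π / n)`. -/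
def polyR (n : ℕ) : ℝ := 1 / Real.cos (Real.pi / n)

/-- `σ_n = 1 / (1 + r_n)`. -/
def polySigma (n : ℕ) : ℝ := 1 / (1 + polyR n)

/-- The points `s_k`, `1 ≤ k ≤ n`, are the vertices of the `n`-gon state space. -/
def polyVertex (n k : ℕ) : Fin 3 → ℝ :=
  ![polyR n * Real.cos (2 * k * Real.pi / n), polyR n * Real.sin (2 * k * Real.pi / n), 1]

/-- The `n`-gon state space, embedded in `ℝ³` on the plane `z = 1`. -/
def polygon (n : ℕ) : Set (Fin 3 → ℝ) :=
  convexHull ℝ (polyVertex n '' Set.Icc 1 n)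

/-- The linear functional `s ↦ e · s` on `ℝ³` that is identified with the vector
`e = (a₁, a₂, z)`, for `a = (a₁, a₂)`. -/
def vecFunctional (a : Fin 2 → ℝ) (z : ℝ) : Module.Dual ℝ (Fin 3 → ℝ) :=
  dotProductEquiv ℝ (Fin 3) ![a 0, a 1, z]

/-- The gauge `η_e^n`, a maximum over `k ∈ {1, …, n}`. -/
def etaE (n : ℕ) (a : Fin 2 → ℝ) : ℝ :=
  ⨆ k : Set.Icc 1 n,
    polyR n * (Real.cos (2 * Real.pi * (k : ℕ) / n) * a 0
      + Real.sin (2 * Real.pi * (k : ℕ) / n) * a 1)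

/-- The gauge `η_o^n`, a maximum over `k ∈ {1, …, n}`. -/
def etaO (n : ℕ) (a : Fin 2 → ℝ) : ℝ :=
  ⨆ k : Set.Icc 1 n,
    polyR n * (Real.cos ((2 * (k : ℕ) - 1) * Real.pi / n) * a 0
      + Real.sin ((2 * (k : ℕ) - 1) * Real.pi / n) * a 1)

end GPT

end

/-!
Write `u i` for the unit vector in the direction of the vertex `i` of the polygon, and identify a
functional with a pair `(w, q)` of a planar vector and a number. As `n` is odd, the edge opposite to
the vertex `i` is orthogonal to `u i`, and the pairs `(u i, 1)`, called rays, span the extreme rays of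
the cone of functionals that are nonnegative on the polygon (`eq_smul_ray`, `mem_span_rays`). Hence
every observable is a post-processing of one whose effects are multiples of rays. If `B` is of this
kind, then any common refinement of `A` and `B` also consists of multiples of the rays in `B`
(`nonneg_of_compatible_rays`), so `A` is compatible with `B` only if its effects lie in the cone
spanned by these rays.

Three rays can be weighted to an observable exactly when the triangle of the corresponding points
`u i` contains the origin. The argument above shows that, for `A` in `T3`, the point `w / q` of each
nonzero effect of `A` lies in all these triangles. Their intersection is cut out by the longest
diagonals, at distance `cos (m π / n) = sin (π / (2 n))` from the origin and with normals in the
directions `(2 c - m) π / n`; hence the distinction by the parity of `m`. Triangles with a leg along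
each longest diagonal give necessity (`component_le_of_mem_T3`). The shorter sides of the other
triangles impose nothing new (`component_le_of_parity`, `edge_nonneg`).

For sufficiency, let the effects of `B` be decomposed into rays, and let `β k` be the total weight of
the ray `k`; these weights have barycentre zero. By Carathéodory's theorem they are a sum of such
weights on triangles that contain the origin, and on each triangle the barycentric coordinates of
`w / q`, for the effects of `A`, are nonnegative and average to the given weights. Adding up, the
effects of `A` are split into rays with the same total weights `β k` (`hasTransport_of_balanced`), so
both `A` and `B` are post-processings of the observable with effects `β k • ray n k`
(`mem_T3_of_component_le`).
-/

open scoped NNReal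

namespace GPT

/-! ### Cosines and sines of multiples of `π / n` -/

/-- The cosine of `t` steps of `π / n`. -/
noncomputable def cosStep (n : ℕ) (t : ℤ) : ℝ := Real.cos (t * Real.pi / n)

/-- The sine of `t` steps of `π / n`. -/
noncomputable def sinStep (n : ℕ) (t : ℤ) : ℝ := Real.sin (t * Real.pi / n)

section Trig

variable {n : ℕ}

theorem cosStep_add (s t : ℤ) :
    cosStep n (s + t) = cosStep n s * cosStep n t - sinStep n s * sinStep n t := by
  simp only [cosStep, sinStep, ← Real.cos_add]; push_cast; ring_nf

theorem sinStep_add (s t : ℤ) :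
    sinStep n (s + t) = sinStep n s * cosStep n t + cosStep n s * sinStep n t := by
  simp only [cosStep, sinStep, ← Real.sin_add]; push_cast; ring_nf

theorem cosStep_neg (t : ℤ) : cosStep n (-t) = cosStep n t := by
  simp only [cosStep, ← Real.cos_neg (t * Real.pi / n)]; push_cast; ring_nf

theorem sinStep_neg (t : ℤ) : sinStep n (-t) = -sinStep n t := by
  simp only [sinStep, ← Real.sin_neg]; push_cast; ring_nf

theorem cosStep_sub (s t : ℤ) :
    cosStep n (s - t) = cosStep n s * cosStep n t + sinStep n s * sinStep n t := by
  rw [sub_eq_add_neg, cosStep_add, cosStep_neg, sinStep_neg]; ring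

theorem sinStep_sub (s t : ℤ) :
    sinStep n (s - t) = sinStep n s * cosStep n t - cosStep n s * sinStep n t := by
  rw [sub_eq_add_neg, sinStep_add, cosStep_neg, sinStep_neg]; ring

theorem cosStep_sq_add_sinStep_sq (t : ℤ) : cosStep n t ^ 2 + sinStep n t ^ 2 = 1 :=
  Real.cos_sq_add_sin_sq _

theorem cosStep_self (hn : n ≠ 0) : cosStep n n = -1 := by
  have : (n : ℝ) ≠ 0 := by exact_mod_cast hn
  rw [cosStep, Int.cast_natCast, mul_div_cancel_left₀ _ this, Real.cos_pi]

theorem sinStep_self (hn : n ≠ 0) : sinStep n n = 0 := by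
  have : (n : ℝ) ≠ 0 := by exact_mod_cast hn
  rw [sinStep, Int.cast_natCast, mul_div_cancel_left₀ _ this, Real.sin_pi]

theorem cosStep_add_self (hn : n ≠ 0) (t : ℤ) : cosStep n (t + n) = -cosStep n t := by
  rw [cosStep_add, cosStep_self hn, sinStep_self hn]; ring

theorem sinStep_add_self (hn : n ≠ 0) (t : ℤ) : sinStep n (t + n) = -sinStep n t := by
  rw [sinStep_add, cosStep_self hn, sinStep_self hn]; ring

theorem cosStep_add_period (hn : n ≠ 0) (t j : ℤ) : cosStep n (t + 2 * (n * j)) = cosStep n t := by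
  have : (n : ℝ) ≠ 0 := by exact_mod_cast hn
  rw [cosStep, cosStep, ← Real.cos_add_int_mul_two_pi (t * Real.pi / n) j]
  congr 1; push_cast; field_simp

theorem sinStep_add_period (hn : n ≠ 0) (t j : ℤ) : sinStep n (t + 2 * (n * j)) = sinStep n t := by
  have : (n : ℝ) ≠ 0 := by exact_mod_cast hn
  rw [sinStep, sinStep, ← Real.sin_add_int_mul_two_pi (t * Real.pi / n) j]
  congr 1; push_cast; field_simp

theorem cosStep_le_cosStep (hn : n ≠ 0) {s t : ℤ} (hst : |s| ≤ t) (ht : t ≤ n) :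
    cosStep n t ≤ cosStep n s := by
  have hn0 : (0 : ℝ) < n := by exact_mod_cast Nat.pos_of_ne_zero hn
  have hst' : |(s : ℝ)| ≤ t := by exact_mod_cast hst
  have ht' : (t : ℝ) ≤ n := by exact_mod_cast ht
  have h1 : |(s : ℝ) * Real.pi / n| ≤ t * Real.pi / n := by
    rw [abs_div, abs_mul, abs_of_pos Real.pi_pos, abs_of_pos hn0]; gcongr
  rw [cosStep, cosStep, ← Real.cos_abs (s * Real.pi / n)]
  refine Real.cos_le_cos_of_nonneg_of_le_pi (abs_nonneg _) ?_ h1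
  rw [div_le_iff₀ hn0, mul_comm]; gcongr

theorem sinStep_nonneg {t : ℤ} (h0 : 0 ≤ t) (ht : t ≤ n) : 0 ≤ sinStep n t := by
  have h0' : (0 : ℝ) ≤ t := by exact_mod_cast h0
  have ht' : (t : ℝ) ≤ n := by exact_mod_cast ht
  refine Real.sin_nonneg_of_nonneg_of_le_pi (by positivity) ?_
  refine div_le_of_le_mul₀ (by positivity) (by positivity) ?_
  rw [mul_comm]; gcongr

theorem sinStep_pos {t : ℤ} (h0 : 0 < t) (ht : t < n) : 0 < sinStep n t := by
  have hn0 : (0 : ℝ) < n := by exact_mod_cast h0.trans ht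
  have h0' : (0 : ℝ) < t := by exact_mod_cast h0
  have ht' : (t : ℝ) < n := by exact_mod_cast ht
  refine Real.sin_pos_of_pos_of_lt_pi (by positivity) ?_
  rw [div_lt_iff₀ hn0, mul_comm]; gcongr

theorem cosStep_pos {t : ℤ} (h : 2 * |t| < n) : 0 < cosStep n t := by
  have hn0 : (0 : ℝ) < n := by
    have : (0 : ℤ) < n := lt_of_le_of_lt (by positivity) h
    exact_mod_cast this
  have h' : 2 * |(t : ℝ)| < n := by exact_mod_cast h
  have h1 : |(t : ℝ) * Real.pi / n| < Real.pi / 2 := by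
    rw [abs_div, abs_mul, abs_of_pos Real.pi_pos, abs_of_pos hn0, div_lt_div_iff₀ hn0 two_pos]
    nlinarith [Real.pi_pos]
  exact Real.cos_pos_of_mem_Ioo (abs_lt.1 h1)

theorem pos_lt_of_sinStep_pos (hn : n ≠ 0) {t : ℤ} (h0 : 0 ≤ t) (ht : t ≤ 2 * n)
    (h : 0 < sinStep n t) : 0 < t ∧ t < n := by
  constructor
  · rcases h0.eq_or_lt with rfl | h0
    · simp [sinStep] at h
    · exact h0
  · by_contra! hlt
    have h1 := sinStep_nonneg (n := n) (t := t - n) (by omega) (by omega)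
    have h2 := sinStep_add_self hn (t - n)
    rw [sub_add_cancel] at h2
    linarith

/-- The numbers `cos (t π / n)` with `t` odd are at most `cos (π / n)`. -/
theorem cosStep_le_cosStep_one (hn : n ≠ 0) {t : ℤ} (ht : Odd t) : cosStep n t ≤ cosStep n 1 := by
  obtain ⟨a, rfl⟩ := ht
  have hn' : (0 : ℤ) < 2 * n := by omega
  have h1 := Int.emod_nonneg (2 * a + 1) hn'.ne'
  have h2 := Int.emod_lt_of_pos (2 * a + 1) hn'
  have h3 := Int.emod_add_mul_ediv (2 * a + 1) (2 * n)
  set s := (2 * a + 1) % (2 * n)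
  set j := (2 * a + 1) / (2 * n)
  have hodd : s % 2 = 1 := by
    have : s = 2 * (a - n * j) + 1 := by linear_combination h3
    omega
  rw [← h3, mul_assoc, cosStep_add_period hn]
  have key : ∀ s' : ℤ, 1 ≤ s' → s' ≤ n → cosStep n s' ≤ cosStep n 1 :=
    fun s' h h' => cosStep_le_cosStep hn (by simpa using h) h'
  rcases le_total s n with h | h
  · exact key s (by omega) h
  · have := key (2 * n - s) (by omega) (by omega)
    rwa [← cosStep_neg, ← cosStep_add_period hn _ 1,
      show -(2 * (n : ℤ) - s) + 2 * (n * 1) = s by ring] at this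

theorem sinStep_two_mul_ne_zero (hn : Odd n) {t : ℤ} (ht : ¬ (n : ℤ) ∣ t) :
    sinStep n (2 * t) ≠ 0 := by
  have hn0 : (n : ℝ) ≠ 0 := by exact_mod_cast hn.pos.ne'
  intro h
  obtain ⟨z, hz⟩ := Real.sin_eq_zero_iff.1 h
  have h1 : (z : ℝ) * n = 2 * t := by
    push_cast at hz
    field_simp at hz
    linarith
  have h2 : z * n = 2 * t := by exact_mod_cast h1
  refine ht (IsCoprime.dvd_of_dvd_mul_left (Int.isCoprime_iff_gcd_eq_one.2 ?_) ⟨z, by rw [← h2, mul_comm]⟩)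
  simpa [Int.gcd] using hn

theorem cosStep_half {m : ℕ} (hn : n = 2 * m + 1) :
    cosStep n m = Real.sin (Real.pi / (2 * n)) := by
  have hn0 : (n : ℝ) ≠ 0 := by rw [hn]; positivity
  rw [← Real.cos_pi_div_two_sub, cosStep]
  congr 1
  have : (n : ℝ) = 2 * m + 1 := by rw [hn]; push_cast; ring
  field_simp
  push_cast
  rw [this]; ring

/-- A bound for the component of `w` in every second of the directions `t π / n` bounds its
component in every direction. The directions of the other parity are, up to the factor
`2 cos (π / n)`, sums of their two neighbours. -/
theorem component_le_of_parity {m : ℕ} (hn : n = 2 * m + 1) {q w₀ w₁ : ℝ} (hq : 0 ≤ q)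
    (h : ∀ c : ℤ, cosStep n (2 * c - m) * w₀ + sinStep n (2 * c - m) * w₁ ≤ q * cosStep n m)
    (i : ℤ) {l : ℤ} (hl0 : 0 < l) (hl : l ≤ m) :
    cosStep n (2 * i + l) * w₀ + sinStep n (2 * i + l) * w₁ ≤ q * cosStep n l := by
  have hn0 : n ≠ 0 := by omega
  rcases Int.even_or_odd (l - m) with ⟨d, hd⟩ | ⟨d, hd⟩
  · have h1 := h (i + d + m)
    rw [show 2 * (i + d + m) - (m : ℤ) = 2 * i + l by linarith] at h1
    exact h1.trans (mul_le_mul_of_nonneg_left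
      (cosStep_le_cosStep hn0 (by rwa [abs_of_pos hl0]) (by omega)) hq)
  · have h1 := h (i + d + m + 1)
    have h2 := h (i + d + m)
    rw [show 2 * (i + d + m + 1) - (m : ℤ) = 2 * i + l + 1 by linarith] at h1
    rw [show 2 * (i + d + m) - (m : ℤ) = 2 * i + l - 1 by linarith] at h2
    rw [cosStep_add _ 1, sinStep_add _ 1] at h1
    rw [cosStep_sub _ 1, sinStep_sub _ 1] at h2
    have h3 : cosStep n m ≤ cosStep n (l + 1) :=
      cosStep_le_cosStep hn0 (abs_le.2 ⟨by omega, by omega⟩) (by omega)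
    have h4 : cosStep n m ≤ cosStep n (l - 1) :=
      cosStep_le_cosStep hn0 (abs_le.2 ⟨by omega, by omega⟩) (by omega)
    rw [cosStep_add] at h3
    rw [cosStep_sub] at h4
    have h5 := mul_le_mul_of_nonneg_left (add_le_add h3 h4) hq
    have hpos : 0 < cosStep n 1 := cosStep_pos (by simp; omega)
    refine le_of_mul_le_mul_left ?_ hpos
    linarith

end Trig

/-! ### The polygon and the rays of its effect cone -/

section Polygon

variable {n : ℕ}

theorem vecFunctional_apply (a : Fin 2 → ℝ) (z : ℝ) (s : Fin 3 → ℝ) :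
    vecFunctional a z s = a 0 * s 0 + a 1 * s 1 + z * s 2 := by
  simp [vecFunctional, dotProduct, Fin.sum_univ_three]

theorem exists_eq_vecFunctional (e : Module.Dual ℝ (Fin 3 → ℝ)) :
    ∃ a z, e = vecFunctional a z := by
  obtain ⟨v, rfl⟩ := (dotProductEquiv ℝ (Fin 3)).surjective e
  refine ⟨![v 0, v 1], v 2, ?_⟩
  rw [vecFunctional]
  congr 1
  ext i; fin_cases i <;> rfl

/-- The vertex of the polygon in the direction `2 j π / n`, for any integer `j`. -/
noncomputable def vertex (n : ℕ) (j : ℤ) : Fin 3 → ℝ :=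
  ![polyR n * cosStep n (2 * j), polyR n * sinStep n (2 * j), 1]

/-- The functional `s ↦ 1 + u · s`, with `u` the unit vector in the direction `2 i π / n`. For odd
`n` these span the extreme rays of the cone of functionals that are nonnegative on the polygon. -/
noncomputable def ray (n : ℕ) (i : ℤ) : Module.Dual ℝ (Fin 3 → ℝ) :=
  vecFunctional ![cosStep n (2 * i), sinStep n (2 * i)] 1

theorem exists_mem_Icc_add_mul (hn : n ≠ 0) (j : ℤ) :
    ∃ k ∈ Set.Icc 1 n, ∃ z : ℤ, j = (k : ℤ) + n * z := by
  have hn' : (0 : ℤ) < n := by omega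
  have h1 := Int.emod_nonneg (j - 1) hn'.ne'
  have h2 := Int.emod_lt_of_pos (j - 1) hn'
  have h3 := Int.emod_add_mul_ediv (j - 1) n
  refine ⟨((j - 1) % n).toNat + 1, ⟨by omega, by omega⟩, (j - 1) / n, ?_⟩
  push_cast
  rw [Int.toNat_of_nonneg h1]
  linarith

theorem exists_ray_fin_eq (hn : n ≠ 0) (j : ℤ) : ∃ k : Fin n, ray n (k : ℕ) = ray n j := by
  have hn' : (0 : ℤ) < n := by omega
  have h1 := Int.emod_nonneg j hn'.ne'
  have h2 := Int.emod_lt_of_pos j hn'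
  have h3 := Int.emod_add_mul_ediv j n
  refine ⟨⟨(j % n).toNat, by omega⟩, ?_⟩
  simp only [ray, Int.toNat_of_nonneg h1]
  conv_rhs => rw [← h3]
  rw [mul_add, cosStep_add_period hn, sinStep_add_period hn]

theorem polyVertex_eq_vertex (k : ℕ) : polyVertex n k = vertex n k := by
  simp [polyVertex, vertex, cosStep, sinStep]

theorem vertex_add_mul (hn : n ≠ 0) (j z : ℤ) : vertex n (j + n * z) = vertex n j := by
  simp only [vertex, mul_add, cosStep_add_period hn, sinStep_add_period hn]

theorem vertex_mem_polygon (hn : n ≠ 0) (j : ℤ) : vertex n j ∈ polygon n := by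
  obtain ⟨k, hk, z, rfl⟩ := exists_mem_Icc_add_mul hn j
  rw [vertex_add_mul hn, ← polyVertex_eq_vertex]
  exact subset_convexHull ℝ _ ⟨k, hk, rfl⟩

theorem nonneg_on_polygon {e : Module.Dual ℝ (Fin 3 → ℝ)} (h : ∀ j : ℤ, 0 ≤ e (vertex n j)) :
    ∀ s ∈ polygon n, 0 ≤ e s := by
  intro s hs
  refine convexHull_min (s := polyVertex n '' Set.Icc 1 n) (t := {s | 0 ≤ e s}) ?_
    (convex_halfSpace_ge e.isLinear 0) hs
  rintro _ ⟨k, -, rfl⟩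
  rw [polyVertex_eq_vertex]
  exact h k

theorem vecFunctional_vertex (a : Fin 2 → ℝ) (z : ℝ) (j : ℤ) :
    vecFunctional a z (vertex n j)
      = polyR n * (cosStep n (2 * j) * a 0 + sinStep n (2 * j) * a 1) + z := by
  rw [vecFunctional_apply]; simp [vertex]; ring

theorem third_of_mem_polygon {s : Fin 3 → ℝ} (hs : s ∈ polygon n) : s 2 = 1 := by
  refine convexHull_min (s := polyVertex n '' Set.Icc 1 n) (t := {s | s 2 = 1}) ?_
    (convex_hyperplane (LinearMap.proj (R := ℝ) (φ := fun _ : Fin 3 => ℝ) 2).isLinear 1) hs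
  rintro _ ⟨k, -, rfl⟩
  simp [polyVertex]

variable {m : ℕ}

theorem cosStep_one_pos (hm : 1 ≤ m) (hn : n = 2 * m + 1) : 0 < cosStep n 1 :=
  cosStep_pos (by simp; omega)

theorem polyR_eq : polyR n = 1 / cosStep n 1 := by simp [polyR, cosStep]

theorem polyR_mul (hm : 1 ≤ m) (hn : n = 2 * m + 1) : polyR n * cosStep n 1 = 1 := by
  rw [polyR_eq, one_div, inv_mul_cancel₀ (cosStep_one_pos hm hn).ne']

theorem polyR_pos (hm : 1 ≤ m) (hn : n = 2 * m + 1) : 0 < polyR n := by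
  rw [polyR_eq]; exact one_div_pos.2 (cosStep_one_pos hm hn)

theorem polySigma_pos (hm : 1 ≤ m) (hn : n = 2 * m + 1) : 0 < polySigma n :=
  one_div_pos.2 (by linarith [polyR_pos hm hn])

theorem ray_nonneg (hm : 1 ≤ m) (hn : n = 2 * m + 1) (i : ℤ) : ∀ s ∈ polygon n, 0 ≤ ray n i s := by
  refine nonneg_on_polygon fun j => ?_
  have hn0 : n ≠ 0 := by omega
  have h1 : cosStep n (2 * j - 2 * i + n) ≤ cosStep n 1 :=
    cosStep_le_cosStep_one hn0 ⟨j - i + m, by rw [hn]; push_cast; ring⟩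
  rw [cosStep_add_self hn0, cosStep_sub] at h1
  have h2 := mul_le_mul_of_nonneg_left h1 (polyR_pos hm hn).le
  rw [polyR_mul hm hn] at h2
  rw [ray, vecFunctional_vertex]
  simp only [Matrix.cons_val_zero, Matrix.cons_val_one]
  linarith

/-- The functionals that vanish on the edge opposite to the vertex `i` are the multiples of
`ray n i`. -/
theorem eq_smul_ray (hm : 1 ≤ m) (hn : n = 2 * m + 1) (e : Module.Dual ℝ (Fin 3 → ℝ)) (i : ℤ)
    (h1 : e (vertex n (i + m)) = 0) (h2 : e (vertex n (i + m + 1)) = 0) :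
    ∃ z : ℝ, e = z • ray n i := by
  obtain ⟨a, z, rfl⟩ := exists_eq_vecFunctional e
  have hn0 : n ≠ 0 := by omega
  have hs : 0 < sinStep n 1 := sinStep_pos one_pos (by omega)
  have hr := polyR_mul hm hn
  have hr0 := polyR_pos hm hn
  rw [vecFunctional_vertex, show 2 * (i + m) = 2 * i - 1 + (n : ℤ) by rw [hn]; push_cast; ring,
    cosStep_add_self hn0, sinStep_add_self hn0, cosStep_sub, sinStep_sub] at h1
  rw [vecFunctional_vertex, show 2 * (i + m + 1) = 2 * i + 1 + (n : ℤ) by rw [hn]; push_cast; ring,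
    cosStep_add_self hn0, sinStep_add_self hn0, cosStep_add, sinStep_add] at h2
  have hu := cosStep_sq_add_sinStep_sq (n := n) (2 * i)
  have hradial : cosStep n (2 * i) * a 0 + sinStep n (2 * i) * a 1 = z := by
    linear_combination (-1 / 2) * h1 - (1 / 2) * h2
      - (cosStep n (2 * i) * a 0 + sinStep n (2 * i) * a 1) * hr
  have htangent : sinStep n (2 * i) * a 0 - cosStep n (2 * i) * a 1 = 0 := by
    have : (2 * polyR n * sinStep n 1) * (sinStep n (2 * i) * a 0 - cosStep n (2 * i) * a 1) = 0 := by
      linear_combination h2 - h1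
    exact (mul_eq_zero.1 this).resolve_left (by positivity)
  refine ⟨z, LinearMap.ext fun s => ?_⟩
  rw [LinearMap.smul_apply, ray, vecFunctional_apply, vecFunctional_apply, smul_eq_mul]
  simp only [Matrix.cons_val_zero, Matrix.cons_val_one]
  have ha0 : a 0 = z * cosStep n (2 * i) := by
    linear_combination cosStep n (2 * i) * hradial + sinStep n (2 * i) * htangent - a 0 * hu
  have ha1 : a 1 = z * sinStep n (2 * i) := by
    linear_combination sinStep n (2 * i) * hradial - cosStep n (2 * i) * htangent - a 1 * hu
  rw [ha0, ha1]; ring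

theorem ray_vertex_self (i : ℤ) : ray n i (vertex n i) = polyR n + 1 := by
  rw [ray, vecFunctional_vertex]
  simp only [Matrix.cons_val_zero, Matrix.cons_val_one]
  linear_combination polyR n * cosStep_sq_add_sinStep_sq (n := n) (2 * i)

theorem ray_vertex_opposite (hm : 1 ≤ m) (hn : n = 2 * m + 1) (i : ℤ) :
    ray n i (vertex n (i + m)) = 0 ∧ ray n i (vertex n (i + m + 1)) = 0 := by
  have hn0 : n ≠ 0 := by omega
  have hr := polyR_mul hm hn
  have hu := cosStep_sq_add_sinStep_sq (n := n) (2 * i)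
  rw [ray, vecFunctional_vertex, vecFunctional_vertex,
    show 2 * (i + m) = 2 * i - 1 + (n : ℤ) by rw [hn]; push_cast; ring,
    show 2 * (i + m + 1) = 2 * i + 1 + (n : ℤ) by rw [hn]; push_cast; ring,
    cosStep_add_self hn0, sinStep_add_self hn0, cosStep_sub, sinStep_sub,
    cosStep_add_self hn0, sinStep_add_self hn0, cosStep_add, sinStep_add]
  simp only [Matrix.cons_val_zero, Matrix.cons_val_one]
  constructor <;> linear_combination -(polyR n * cosStep n 1) * hu - hr

/-- The polygon spans the ambient space. -/
theorem ext_on_polygon (hm : 1 ≤ m) (hn : n = 2 * m + 1) {e f : Module.Dual ℝ (Fin 3 → ℝ)}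
    (h : ∀ s ∈ polygon n, e s = f s) : e = f := by
  have hn0 : n ≠ 0 := by omega
  have hv : ∀ j : ℤ, (e - f) (vertex n j) = 0 := fun j => by
    rw [LinearMap.sub_apply, h _ (vertex_mem_polygon hn0 j), sub_self]
  obtain ⟨z, hz⟩ := eq_smul_ray hm hn (e - f) 0 (hv _) (hv _)
  have h0 := hv 0
  rw [hz, LinearMap.smul_apply, ray_vertex_self, smul_eq_mul] at h0
  have hz0 := (mul_eq_zero.1 h0).resolve_right (by linarith [polyR_pos hm hn])
  rw [hz0, zero_smul] at hz
  exact sub_eq_zero.1 hz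

/-- The unit functional is a positive combination of the rays of the isosceles triangle with
apex `c` and base of one step. -/
theorem triangle_sum (hn : n = 2 * m + 1) (c : ℤ) :
    ray n (c - m) + ray n (c + m) + (2 * cosStep n 1) • ray n c
      = (2 + 2 * cosStep n 1) • vecFunctional 0 1 := by
  have hn0 : n ≠ 0 := by omega
  have h1 : cosStep n (2 * m) = -cosStep n 1 := by
    rw [show 2 * (m : ℤ) = -1 + n by rw [hn]; push_cast; ring, cosStep_add_self hn0, cosStep_neg]
  refine LinearMap.ext fun s => ?_
  simp only [LinearMap.add_apply, LinearMap.smul_apply, ray, vecFunctional_apply, smul_eq_mul,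
    Matrix.cons_val_zero, Matrix.cons_val_one, mul_sub, mul_add, cosStep_sub, sinStep_sub,
    cosStep_add, sinStep_add, Pi.zero_apply]
  linear_combination 2 * (cosStep n (2 * c) * s 0 + sinStep n (2 * c) * s 1) * h1

end Polygon

/-! ### Transport between planar weights -/

/-- The planar cross product (signed area). -/
def cross (p q : ℝ × ℝ) : ℝ := p.1 * q.2 - p.2 * q.1

/-- `HasTransport u q w β`: the weights `β` on the points `u k` can be split among the indices `x` so
that the share of `x` has total mass proportional to `q x` and first moment proportional to `w x`,
with constant of proportionality the total mass of `β`. For `β` of mass one this is a martingale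
coupling of the points `w x / q x`, taken with the probabilities `q x`, with the points `u k`. -/
def HasTransport {K Ω : Type*} [Fintype K] [Fintype Ω] (u : K → ℝ × ℝ) (q : Ω → ℝ)
    (w : Ω → ℝ × ℝ) (β : K → ℝ) : Prop :=
  ∃ c : Ω → K → ℝ, (∀ x k, 0 ≤ c x k) ∧ (∀ x, ∑ k, c x k = (∑ k, β k) * q x) ∧
    (∀ x, ∑ k, c x k • u k = (∑ k, β k) • w x) ∧ ∀ k, ∑ x, c x k = β k

section Transport

variable {K Ω : Type*} [Fintype K] [Fintype Ω] {u : K → ℝ × ℝ} {q : Ω → ℝ} {w : Ω → ℝ × ℝ}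

theorem HasTransport.zero : HasTransport u q w (0 : K → ℝ) :=
  ⟨0, by simp, by simp, by simp, by simp⟩

theorem HasTransport.add {β γ : K → ℝ} (hβ : HasTransport u q w β) (hγ : HasTransport u q w γ) :
    HasTransport u q w (β + γ) := by
  obtain ⟨c, hc0, hc1, hc2, hc3⟩ := hβ
  obtain ⟨d, hd0, hd1, hd2, hd3⟩ := hγ
  refine ⟨c + d, fun x k => add_nonneg (hc0 x k) (hd0 x k), fun x => ?_, fun x => ?_, fun k => ?_⟩
  · simp only [Pi.add_apply, Finset.sum_add_distrib, hc1, hd1]; ring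
  · simp only [Pi.add_apply, Finset.sum_add_distrib, add_smul, hc2, hd2]
  · simp only [Pi.add_apply, Finset.sum_add_distrib, hc3, hd3]

theorem sum_single_smul [DecidableEq K] (l : K) (t : ℝ) :
    ∑ k, (Pi.single l t : K → ℝ) k • u k = t • u l := by
  rw [Finset.sum_eq_single l] <;> simp +contextual

/-- For weights on a triangle that are balanced about the origin, the transport is given by the
barycentric coordinates of the points `w x / q x`; `hedge` makes them nonnegative. -/
theorem hasTransport_triangle [DecidableEq K] (hq : ∑ x, q x = 1) (hw : ∑ x, w x = 0)
    (hedge : ∀ i j, 0 < cross (u i) (u j) → ∀ x, 0 ≤ q x * cross (u i) (u j) - cross (w x) (u j - u i))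
    {i j k : K} {a b c : ℝ} (ha : 0 < a) (hb : 0 < b) (hc : 0 < c)
    (h : a • u i + b • u j + c • u k = 0) (hne : cross (u i) (u j) ≠ 0) :
    HasTransport u q w (Pi.single i a + Pi.single j b + Pi.single k c) := by
  wlog hpos : 0 < cross (u i) (u j) generalizing i j a b
  · have hflip : cross (u j) (u i) = -cross (u i) (u j) := by simp only [cross]; ring
    rw [add_comm (Pi.single i a : K → ℝ)]
    exact this hb ha (by rw [← h]; abel) (by rw [hflip]; exact neg_ne_zero.2 hne)
      (by rw [hflip]; exact neg_pos.2 (lt_of_le_of_ne (not_lt.1 hpos) hne))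
  have h1 : a * (u i).1 + b * (u j).1 + c * (u k).1 = 0 := by simpa using congrArg Prod.fst h
  have h2 : a * (u i).2 + b * (u j).2 + c * (u k).2 = 0 := by simpa using congrArg Prod.snd h
  have hjk : c * cross (u j) (u k) = a * cross (u i) (u j) := by
    simp only [cross]; linear_combination (u j).1 * h2 - (u j).2 * h1
  have hki : c * cross (u k) (u i) = b * cross (u i) (u j) := by
    simp only [cross]; linear_combination (u i).2 * h1 - (u i).1 * h2
  have hjk0 : 0 < cross (u j) (u k) := pos_of_mul_pos_right (hjk ▸ mul_pos ha hpos) hc.le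
  have hki0 : 0 < cross (u k) (u i) := pos_of_mul_pos_right (hki ▸ mul_pos hb hpos) hc.le
  -- `D` is twice the area of the triangle.
  set D := cross (u i) (u j) + cross (u j) (u k) + cross (u k) (u i) with hD
  have hD0 : 0 < D := by positivity
  have hcD : c * D = (a + b + c) * cross (u i) (u j) := by
    rw [hD]; linear_combination hjk + hki
  have hij' : (a + b + c) / D * cross (u i) (u j) = c := by
    rw [div_mul_eq_mul_div, div_eq_iff hD0.ne', hcD]
  have hjk' : (a + b + c) / D * cross (u j) (u k) = a := by
    rw [div_mul_eq_mul_div, div_eq_iff hD0.ne']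
    refine mul_left_cancel₀ hc.ne' ?_
    linear_combination (a + b + c) * hjk - a * hcD
  have hki' : (a + b + c) / D * cross (u k) (u i) = b := by
    rw [div_mul_eq_mul_div, div_eq_iff hD0.ne']
    refine mul_left_cancel₀ hc.ne' ?_
    linear_combination (a + b + c) * hki - b * hcD
  let T := (a + b + c) / D
  have hT : 0 ≤ T := by positivity
  have hTD : T * D = a + b + c := div_mul_cancel₀ _ hD0.ne'
  let E : K → K → Ω → ℝ := fun i j x => T * (q x * cross (u i) (u j) - cross (w x) (u j - u i))
  have hmass : ∑ l, (Pi.single i a + Pi.single j b + Pi.single k c : K → ℝ) l = a + b + c := by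
    simp [Finset.sum_add_distrib]
  have hE : ∀ i j, 0 < cross (u i) (u j) → ∀ x, 0 ≤ E i j x :=
    fun i j hij x => mul_nonneg hT (hedge i j hij x)
  have hw1 : ∑ x, (w x).1 = 0 := by rw [← Prod.fst_sum, hw, Prod.fst_zero]
  have hw2 : ∑ x, (w x).2 = 0 := by rw [← Prod.snd_sum, hw, Prod.snd_zero]
  have hEsum : ∀ i j, ∑ x, E i j x = T * cross (u i) (u j) := by
    intro i j
    simp only [E, ← Finset.mul_sum, Finset.sum_sub_distrib, ← Finset.sum_mul, hq, cross,
      hw1, hw2]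
    ring
  refine ⟨fun x => Pi.single i (E j k x) + Pi.single j (E k i x) + Pi.single k (E i j x),
    fun x l => ?_, fun x => ?_, fun x => ?_, fun l => ?_⟩
  · have e1 := hE _ _ hjk0 x
    have e2 := hE _ _ hki0 x
    have e3 := hE _ _ hpos x
    simp only [Pi.add_apply, Pi.single_apply]
    split_ifs <;> positivity
  · rw [hmass, ← hTD]
    simp only [Pi.add_apply, Finset.sum_add_distrib, Finset.sum_pi_single', Finset.mem_univ, if_true]
    simp only [E, hD, cross, Prod.fst_sub, Prod.snd_sub]
    ring
  · rw [hmass, ← hTD]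
    simp only [Pi.add_apply, add_smul, Finset.sum_add_distrib, sum_single_smul]
    ext
    · simp only [E, hD, cross, Prod.fst_sub, Prod.snd_sub, Prod.fst_add, Prod.smul_fst, smul_eq_mul]
      ring
    · simp only [E, hD, cross, Prod.fst_sub, Prod.snd_sub, Prod.snd_add, Prod.smul_snd, smul_eq_mul]
      ring
  · have hs : ∀ (l' : K) (f : Ω → ℝ), ∑ x, (Pi.single l' (f x) : K → ℝ) l
        = (Pi.single l' (∑ x, f x) : K → ℝ) l := by
      intro l' f
      by_cases hl : l = l' <;> simp [hl]
    simp only [Pi.add_apply, Finset.sum_add_distrib, hs, hEsum]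
    rw [hjk', hki', hij']

/-- Carathéodory's theorem in the plane: balanced weights dominate, up to a factor, balanced weights
on a nondegenerate triangle. -/
theorem exists_triangle [DecidableEq K] (hu : ∀ i j, cross (u i) (u j) = 0 → i = j) (hu0 : ∀ i, u i ≠ 0)
    {β : K → ℝ} (hβ : ∀ k, 0 ≤ β k) (hβ0 : β ≠ 0) (hsum : ∑ k, β k • u k = 0) :
    ∃ (i j k : K) (a b c : ℝ), 0 < β i ∧ 0 < β j ∧ 0 < β k ∧ 0 < a ∧ 0 < b ∧ 0 < c ∧
      a • u i + b • u j + c • u k = 0 ∧ cross (u i) (u j) ≠ 0 := by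
  classical
  have hmem : (0 : ℝ × ℝ) ∈ convexHull ℝ (u '' {k | 0 < β k}) := by
    have h0 : ∑ k ∈ Finset.univ.filter (fun k => 0 < β k), β k • u k = 0 := by
      rw [← hsum, Finset.sum_filter]
      refine Finset.sum_congr rfl fun k _ => ?_
      split_ifs with h
      · rfl
      · rw [le_antisymm (not_lt.1 h) (hβ k), zero_smul]
    have := Finset.centerMass_mem_convexHull (R := ℝ) (s := u '' {k | 0 < β k})
      (Finset.univ.filter (fun k => 0 < β k)) (w := β) (z := u)
      (fun k _ => hβ k) ?_ (fun k hk => ⟨k, (Finset.mem_filter.1 hk).2, rfl⟩)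
    · rwa [Finset.centerMass, h0, smul_zero] at this
    · obtain ⟨k, hk⟩ := Function.ne_iff.1 hβ0
      exact Finset.sum_pos (fun k hk => (Finset.mem_filter.1 hk).2)
        ⟨k, Finset.mem_filter.2 ⟨Finset.mem_univ _, lt_of_le_of_ne (hβ k) (Ne.symm hk)⟩⟩
  obtain ⟨ι, _, z, t, hz, hind, ht, ht1, htz⟩ := eq_pos_convex_span_of_mem_convexHull hmem
  choose κ hκ using fun i => hz (Set.mem_range_self i)
  have hcard : Fintype.card ι ≤ 3 := by
    have h := hind.card_le_finrank_succ
    have h' := Submodule.finrank_le (vectorSpan ℝ (Set.range z))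
    have : Module.finrank ℝ (ℝ × ℝ) = 2 := by simp
    omega
  obtain ⟨d, hd⟩ : ∃ d, d = Fintype.card ι := ⟨_, rfl⟩
  let e : ι ≃ Fin d := Fintype.equivFinOfCardEq hd.symm
  have hinj : ∀ i j : Fin d, κ (e.symm i) = κ (e.symm j) → i = j := by
    intro i j hij
    refine e.symm.injective (hind.injective ?_)
    rw [← (hκ _).2, ← (hκ (e.symm j)).2, hij]
  have hsum' : ∑ i : Fin d, t (e.symm i) • u (κ (e.symm i)) = 0 := by
    rw [← htz, ← e.symm.sum_comp]
    exact Finset.sum_congr rfl fun i _ => by rw [(hκ _).2]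
  have hd3 : d ≤ 3 := hd ▸ hcard
  interval_cases d
  · have : IsEmpty ι := e.isEmpty
    simp at ht1
  · rw [Fin.sum_univ_one] at hsum'
    exact absurd ((smul_eq_zero.1 hsum').resolve_left (ht _).ne') (hu0 _)
  · rw [Fin.sum_univ_two] at hsum'
    have h1 := congrArg Prod.fst hsum'
    have h2 := congrArg Prod.snd hsum'
    simp only [Prod.fst_add, Prod.snd_add, Prod.smul_fst, Prod.smul_snd, smul_eq_mul,
      Prod.fst_zero, Prod.snd_zero] at h1 h2
    have hcross : t (e.symm 1) * cross (u (κ (e.symm 0))) (u (κ (e.symm 1))) = 0 := by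
      simp only [cross]
      linear_combination (u (κ (e.symm 0))).1 * h2 - (u (κ (e.symm 0))).2 * h1
    have := hinj _ _ (hu _ _ ((mul_eq_zero.1 hcross).resolve_left (ht _).ne'))
    simp at this
  · rw [Fin.sum_univ_three] at hsum'
    refine ⟨_, _, _, _, _, _, (hκ _).1, (hκ _).1, (hκ _).1, ht _, ht _, ht _, hsum', fun h => ?_⟩
    have := hinj _ _ (hu _ _ h)
    simp at this

/-- Balanced weights are a sum of balanced weights on triangles, by induction on the size of the
support: subtract the largest multiple of a triangle that leaves nonnegative weights. -/
theorem hasTransport_of_balanced (hq : ∑ x, q x = 1) (hw : ∑ x, w x = 0)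
    (hedge : ∀ i j, 0 < cross (u i) (u j) → ∀ x, 0 ≤ q x * cross (u i) (u j) - cross (w x) (u j - u i))
    (hu : ∀ i j, cross (u i) (u j) = 0 → i = j) (hu0 : ∀ i, u i ≠ 0)
    {β : K → ℝ} (hβ : ∀ k, 0 ≤ β k) (hsum : ∑ k, β k • u k = 0) : HasTransport u q w β := by
  classical
  induction hN : (Finset.univ.filter (fun k => β k ≠ 0)).card using Nat.strong_induction_on
    generalizing β with
  | _ N ih =>
  by_cases hβ0 : β = 0
  · rw [hβ0]; exact HasTransport.zero
  obtain ⟨i, j, k, a, b, c, hi, hj, hk, ha, hb, hc, h, hne⟩ := exists_triangle hu hu0 hβ hβ0 hsum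
  set τ : K → ℝ := Pi.single i a + Pi.single j b + Pi.single k c with hτ
  have hτsum : ∑ l, τ l • u l = 0 := by
    simp only [hτ, Pi.add_apply, add_smul, Finset.sum_add_distrib, sum_single_smul, h]
  have hτ0 : ∀ l, 0 ≤ τ l := by
    intro l
    simp only [hτ, Pi.add_apply, Pi.single_apply]
    split_ifs <;> positivity
  have hτβ : ∀ l, β l = 0 → τ l = 0 := by
    intro l hl
    have h1 : l ≠ i := by rintro rfl; exact hi.ne' hl
    have h2 : l ≠ j := by rintro rfl; exact hj.ne' hl
    have h3 : l ≠ k := by rintro rfl; exact hk.ne' hl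
    simp [hτ, h1, h2, h3]
  have hτi : 0 < τ i := by
    simp only [hτ, Pi.add_apply, Pi.single_apply]
    split_ifs <;> positivity
  obtain ⟨l, hl, hmin⟩ := Finset.exists_min_image (Finset.univ.filter fun l => 0 < τ l)
    (fun l => β l / τ l) ⟨i, by simpa using hτi⟩
  have hτl : 0 < τ l := (Finset.mem_filter.1 hl).2
  have hβl : 0 < β l := lt_of_le_of_ne (hβ l) fun h0 => hτl.ne' (hτβ l h0.symm)
  set t := β l / τ l with ht
  have ht0 : 0 < t := div_pos hβl hτl
  have hrest : ∀ l', 0 ≤ (β - t • τ) l' := by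
    intro l'
    simp only [Pi.sub_apply, Pi.smul_apply, smul_eq_mul, sub_nonneg]
    rcases (hτ0 l').eq_or_lt with h0 | h0
    · rw [← h0, mul_zero]; exact hβ l'
    · exact (le_div_iff₀ h0).1 (hmin l' (by simpa using h0))
  have hlt : (Finset.univ.filter (fun l' => (β - t • τ) l' ≠ 0)).card < N := by
    rw [← hN]
    refine Finset.card_lt_card (Finset.ssubset_iff_of_subset ?_ |>.2 ⟨l, ?_, ?_⟩)
    · intro l' hl'
      simp only [Finset.mem_filter, Finset.mem_univ, true_and] at hl' ⊢
      exact fun h0 => hl' (by simp [h0, hτβ l' h0])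
    · simpa using hβl.ne'
    · simp [ht, div_mul_cancel₀ _ hτl.ne']
  have hrec := ih _ hlt hrest (by
    simp only [Pi.sub_apply, Pi.smul_apply, sub_smul, Finset.sum_sub_distrib, hsum, smul_assoc,
      ← Finset.smul_sum, hτsum, smul_zero, sub_zero]) rfl
  have htri := hasTransport_triangle (i := i) (j := j) (k := k) hq hw hedge (mul_pos ht0 ha)
    (mul_pos ht0 hb) (mul_pos ht0 hc)
    (by simp only [mul_smul, ← smul_add, h, smul_zero]) hne
  have heq : β = (Pi.single i (t * a) + Pi.single j (t * b) + Pi.single k (t * c))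
      + (β - t • τ) := by
    have : (Pi.single i (t * a) + Pi.single j (t * b) + Pi.single k (t * c) : K → ℝ) = t • τ := by
      simp only [hτ, smul_add, ← Pi.single_smul, smul_eq_mul]
    rw [this]; abel
  rw [heq]
  exact htri.add hrec

end Transport

/-! ### Observables and post-processing -/

section Observables

variable {V : Type*} [AddCommGroup V] [Module ℝ V] {S : Set V}

/-- Nonnegative functionals that sum to the unit effect are automatically at most one. -/
def Observable.ofNonneg {Λ : Type*} [Fintype Λ] (e : Λ → Module.Dual ℝ V)
    (h0 : ∀ x, ∀ s ∈ S, 0 ≤ e x s) (h1 : ∀ s ∈ S, ∑ x, e x s = 1) : Observable S Λ where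
  effect := e
  mem_effects x s hs := ⟨h0 x s hs, h1 s hs ▸
    Finset.single_le_sum (f := fun x => e x s) (fun y _ => h0 y s hs) (Finset.mem_univ x)⟩
  sum_eq_one := h1

/-- If the effects of `B` are nonnegative combinations of functionals `g k`, and the coefficients of
`g k` sum to `β k`, then `B` is a post-processing of the observable with effects `β k • g k`. -/
theorem postProcesses_of_combination {K Ω : Type*} [Fintype K] [Fintype Ω] {s₀ : V} (hs₀ : s₀ ∈ S)
    {J : Observable S K} {B : Observable S Ω} {g : K → Module.Dual ℝ V} {β : K → ℝ}
    (hJ : ∀ k, J.effect k = β k • g k) {c : Ω → K → ℝ} (hc : ∀ x k, 0 ≤ c x k)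
    (hβ : ∀ k, ∑ x, c x k = β k) (hB : ∀ x, B.effect x = ∑ k, c x k • g k) :
    PostProcesses J B := by
  classical
  have hle : ∀ x k, c x k ≤ β k := fun x k => hβ k ▸
    Finset.single_le_sum (f := fun x => c x k) (fun y _ => hc y k) (Finset.mem_univ x)
  -- An outcome `k` of weight zero does not occur; any probability distribution does for it, and the
  -- outcome distribution of `B` in the state `s₀` is one.
  refine ⟨fun k x => if β k = 0 then B.effect x s₀ else c x k / β k, fun k x => ?_, fun k => ?_,
    fun x s _ => ?_⟩
  · dsimp only
    split_ifs with h
    · exact B.mem_effects x s₀ hs₀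
    · have hpos : 0 < β k := lt_of_le_of_ne ((hc x k).trans (hle x k)) (Ne.symm h)
      exact ⟨div_nonneg (hc x k) hpos.le, (div_le_one hpos).2 (hle x k)⟩
  · dsimp only
    split_ifs with h
    · exact B.sum_eq_one s₀ hs₀
    · rw [← Finset.sum_div, hβ, div_self h]
  · rw [hB, LinearMap.sum_apply]
    refine Finset.sum_congr rfl fun k _ => ?_
    rw [hJ, LinearMap.smul_apply, LinearMap.smul_apply, smul_eq_mul, smul_eq_mul]
    dsimp only
    split_ifs with h
    · rw [h, le_antisymm (h ▸ hle x k) (hc x k)]; ring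
    · field_simp

end Observables

/-! ### Necessity: triangular observables -/

section Necessity

variable {n m : ℕ}

/-- Compatibility with an observable whose effects are multiples of the rays in a set `I` forces
every effect to be nonnegative wherever these rays are: a common refinement has effects dominated
by multiples of the rays, hence themselves multiples of the rays. -/
theorem nonneg_of_compatible_rays (hm : 1 ≤ m) (hn : n = 2 * m + 1) {Ω Ω' : Type*} [Fintype Ω]
    [Fintype Ω'] {A : Observable (polygon n) Ω} {B : Observable (polygon n) Ω'} {κ : Ω' → ℤ}
    {t : Ω' → ℝ} (hB : ∀ y, B.effect y = t y • ray n (κ y)) (hAB : Compatible A B)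
    {p : Fin 3 → ℝ} (hp : ∀ y, 0 ≤ ray n (κ y) p) (x : Ω) : 0 ≤ A.effect x p := by
  have hn0 : n ≠ 0 := by omega
  obtain ⟨Λ, _, J, ⟨ν, hν, -, hA⟩, ⟨μ, hμ, hμ1, hB'⟩⟩ := hAB
  have hAx : A.effect x = ∑ l, ν l x • J.effect l :=
    ext_on_polygon hm hn fun s hs => by simpa using hA x s hs
  rw [hAx, LinearMap.sum_apply]
  refine Finset.sum_nonneg fun l _ => mul_nonneg (hν l x).1 ?_
  obtain ⟨y, hy⟩ : ∃ y, 0 < μ l y := by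
    by_contra! h
    linarith [hμ1 l, Finset.sum_nonpos fun y (_ : y ∈ Finset.univ) => h y]
  have hzero : ∀ j : ℤ, ray n (κ y) (vertex n j) = 0 → J.effect l (vertex n j) = 0 := by
    intro j hj
    have hs := vertex_mem_polygon hn0 j
    have h1 := hB' y _ hs
    rw [hB, LinearMap.smul_apply, hj, smul_zero] at h1
    have h2 := (Finset.sum_eq_zero_iff_of_nonneg fun l' _ =>
      mul_nonneg (hμ l' y).1 (J.mem_effects l' _ hs).1).1 h1.symm l (Finset.mem_univ l)
    exact (mul_eq_zero.1 h2).resolve_left hy.ne'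
  obtain ⟨hv1, hv2⟩ := ray_vertex_opposite hm hn (κ y)
  obtain ⟨z, hz⟩ := eq_smul_ray hm hn _ _ (hzero _ hv1) (hzero _ hv2)
  have hz0 : 0 ≤ z := by
    have h := (J.mem_effects l _ (vertex_mem_polygon hn0 (κ y))).1
    rw [hz, LinearMap.smul_apply, ray_vertex_self, smul_eq_mul] at h
    exact nonneg_of_mul_nonneg_left h (by linarith [polyR_pos hm hn])
  rw [hz, LinearMap.smul_apply]
  exact mul_nonneg hz0 (hp y)

/-- An observable in `T3` is in particular compatible with the observables given by isosceles
triangles whose legs are longest diagonals. -/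
theorem nonneg_of_mem_T3 (hm : 1 ≤ m) (hn : n = 2 * m + 1) {Ω : Type*} [Fintype Ω]
    {A : Observable (polygon n) Ω} (hA : A ∈ T3 (polygon n) Ω) (c : ℤ) {p : Fin 3 → ℝ}
    (h1 : 0 ≤ ray n (c - m) p) (h2 : 0 ≤ ray n (c + m) p) (h3 : 0 ≤ ray n c p) (x : Ω) :
    0 ≤ A.effect x p := by
  have hpos := cosStep_one_pos hm hn
  let κ : Fin 3 → ℤ := ![c - m, c + m, c]
  let t : Fin 3 → ℝ := fun y => (![1, 1, 2 * cosStep n 1] y : ℝ) / (2 + 2 * cosStep n 1)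
  have ht : ∀ y, 0 ≤ t y := by
    intro y
    refine div_nonneg ?_ (by positivity)
    fin_cases y <;> simp [hpos.le]
  refine nonneg_of_compatible_rays hm hn (κ := κ) (t := t) (fun y => rfl)
    (hA (Fin 3) (Observable.ofNonneg (fun y => t y • ray n (κ y))
      (fun y s hs => mul_nonneg (ht y) (ray_nonneg hm hn _ s hs)) fun s hs => ?_)) ?_ x
  · have h := LinearMap.congr_fun (triangle_sum hn c) s
    simp only [LinearMap.add_apply, LinearMap.smul_apply, smul_eq_mul, vecFunctional_apply,
      third_of_mem_polygon hs, Pi.zero_apply] at h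
    simp only [Fin.sum_univ_three, LinearMap.smul_apply, smul_eq_mul, κ, t, Matrix.cons_val_zero,
      Matrix.cons_val_one, Matrix.cons_val]
    field_simp
    linarith
  · intro y
    fin_cases y <;> assumption

theorem component_le_of_mem_T3 (hm : 1 ≤ m) (hn : n = 2 * m + 1) {Ω : Type*} [Fintype Ω]
    {A : Observable (polygon n) Ω} (hA : A ∈ T3 (polygon n) Ω) {x : Ω} {w : Fin 2 → ℝ} {q : ℝ}
    (hx : A.effect x = vecFunctional w q) (c : ℤ) :
    cosStep n (2 * c - m) * w 0 + sinStep n (2 * c - m) * w 1 ≤ q * cosStep n m := by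
  have hn0 : n ≠ 0 := by omega
  -- A functional `(w, q)` takes at this point the value `q * cosStep n m` minus the component of `w`
  -- in the direction `2 c - m`, which is normal to the diagonal from `c - m` to `c`.
  have hray : ∀ k : ℤ, ray n k ![-cosStep n (2 * c - m), -sinStep n (2 * c - m), cosStep n m]
      = cosStep n m - cosStep n (2 * k - (2 * c - m)) := by
    intro k
    rw [ray, vecFunctional_apply, cosStep_sub (2 * k)]
    simp only [Matrix.cons_val_zero, Matrix.cons_val_one, Matrix.cons_val]
    ring
  have h := nonneg_of_mem_T3 hm hn hA c
    (p := ![-cosStep n (2 * c - m), -sinStep n (2 * c - m), cosStep n m]) ?_ ?_ ?_ x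
  · rw [hx, vecFunctional_apply] at h
    simp only [Matrix.cons_val_zero, Matrix.cons_val_one, Matrix.cons_val] at h
    linarith
  · rw [hray, show 2 * (c - m) - (2 * c - m) = -(m : ℤ) by ring, cosStep_neg, sub_self]
  · have hd := sinStep_nonneg (n := n) (t := m) (by omega) (by omega)
    have hd' := sinStep_nonneg (n := n) (t := 2 * m) (by omega) (by omega)
    have h1 := cosStep_add (n := n) (2 * m) m
    have h2 := cosStep_sub (n := n) (2 * m) m
    rw [show 2 * (m : ℤ) - m = m by ring] at h2
    rw [hray, show 2 * (c + m) - (2 * c - m) = 2 * (m : ℤ) + m by ring, h1]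
    nlinarith [mul_nonneg hd hd']
  · rw [hray, show 2 * c - (2 * c - m) = (m : ℤ) by ring, sub_self]

end Necessity

/-! ### Sufficiency: refinement into rays and transport -/

section Sufficiency

variable {n m : ℕ}

/-- A functional that is nonnegative on the polygon is a nonnegative combination of rays: its
direction lies between those of two consecutive rays, and the rest is a multiple of the unit. -/
theorem mem_span_rays (hm : 1 ≤ m) (hn : n = 2 * m + 1) {e : Module.Dual ℝ (Fin 3 → ℝ)}
    (he : ∀ j : ℤ, 0 ≤ e (vertex n j)) :
    e ∈ Submodule.span ℝ≥0 (Set.range fun k : Fin n => ray n (k : ℕ)) := by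
  have hn0 : n ≠ 0 := by omega
  have hnR : (0 : ℝ) < n := by exact_mod_cast Nat.pos_of_ne_zero hn0
  set M := Submodule.span ℝ≥0 (Set.range fun k : Fin n => ray n (k : ℕ))
  have hray : ∀ j : ℤ, ray n j ∈ M := by
    intro j
    obtain ⟨k, hk⟩ := exists_ray_fin_eq hn0 j
    exact hk ▸ Submodule.subset_span ⟨k, rfl⟩
  have hsmul : ∀ (t : ℝ) (f : Module.Dual ℝ (Fin 3 → ℝ)), 0 ≤ t → f ∈ M → t • f ∈ M :=
    fun t f ht hf => M.smul_mem (⟨t, ht⟩ : ℝ≥0) hf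
  have hpos := cosStep_one_pos hm hn
  have hunit : vecFunctional 0 1 ∈ M := by
    have h := hsmul (2 + 2 * cosStep n 1)⁻¹ _ (by positivity)
      (M.add_mem (M.add_mem (hray (0 - m)) (hray (0 + m)))
        (hsmul (2 * cosStep n 1) _ (by positivity) (hray 0)))
    rwa [triangle_sum hn 0, inv_smul_smul₀ (by positivity)] at h
  obtain ⟨w, q, rfl⟩ := exists_eq_vecFunctional e
  obtain ⟨ρ, ψ, hρ, hw0, hw1⟩ : ∃ ρ ψ : ℝ, 0 ≤ ρ ∧ w 0 = ρ * Real.cos ψ ∧ w 1 = ρ * Real.sin ψ :=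
    ⟨‖(⟨w 0, w 1⟩ : ℂ)‖, Complex.arg ⟨w 0, w 1⟩, norm_nonneg _,
      (Complex.norm_mul_cos_arg ⟨w 0, w 1⟩).symm, (Complex.norm_mul_sin_arg ⟨w 0, w 1⟩).symm⟩
  let b := 2 * Real.pi / n
  have hb : 0 < b := by positivity
  let k := ⌊ψ / b⌋
  obtain ⟨θ, hθ⟩ : ∃ θ : ℝ, θ = k * b := ⟨_, rfl⟩
  have hk1 : 0 ≤ ψ - θ := by
    have := (le_div_iff₀ hb).1 (Int.floor_le (ψ / b)); linarith
  have hk2 : 0 ≤ b - (ψ - θ) := by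
    have := (div_lt_iff₀ hb).1 (Int.lt_floor_add_one (ψ / b))
    linarith
  have hbpi : b ≤ Real.pi := by
    have : (2 : ℝ) ≤ n := by exact_mod_cast (by omega : 2 ≤ n)
    rw [div_le_iff₀ hnR]; nlinarith [Real.pi_pos]
  have hsb : 0 < Real.sin b := by
    have := sinStep_pos (n := n) (t := 2) (by norm_num) (by omega)
    simpa [sinStep] using this
  let X := ρ * Real.sin (b - (ψ - θ)) / Real.sin b
  let Y := ρ * Real.sin (ψ - θ) / Real.sin b
  have hX : 0 ≤ X := div_nonneg (mul_nonneg hρ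
    (Real.sin_nonneg_of_nonneg_of_le_pi hk2 (by linarith))) hsb.le
  have hY : 0 ≤ Y := div_nonneg (mul_nonneg hρ
    (Real.sin_nonneg_of_nonneg_of_le_pi hk1 (by linarith))) hsb.le
  have hc1 : cosStep n (2 * k) = Real.cos (θ) := by
    simp only [cosStep, hθ, b]; push_cast; ring_nf
  have hs1 : sinStep n (2 * k) = Real.sin (θ) := by
    simp only [sinStep, hθ, b]; push_cast; ring_nf
  have hc2 : cosStep n (2 * (k + 1)) = Real.cos (θ + b) := by
    simp only [cosStep, hθ, b]; push_cast; ring_nf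
  have hs2 : sinStep n (2 * (k + 1)) = Real.sin (θ + b) := by
    simp only [sinStep, hθ, b]; push_cast; ring_nf
  have hpy := Real.sin_sq_add_cos_sq (θ)
  have hx0 : w 0 = X * cosStep n (2 * k) + Y * cosStep n (2 * (k + 1)) := by
    rw [hw0, hc1, hc2, Real.cos_add]
    simp only [X, Y]
    field_simp
    simp only [Real.sin_sub, Real.cos_sub]
    linear_combination (-ρ * Real.cos ψ * Real.sin b) * hpy
  have hx1 : w 1 = X * sinStep n (2 * k) + Y * sinStep n (2 * (k + 1)) := by
    rw [hw1, hs1, hs2, Real.sin_add]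
    simp only [X, Y]
    field_simp
    simp only [Real.sin_sub, Real.cos_sub]
    linear_combination (-ρ * Real.sin ψ * Real.sin b) * hpy
  -- The vertex opposite to the edge between the two directions.
  have hv := he (k + m + 1)
  have hu := cosStep_sq_add_sinStep_sq (n := n) (2 * k + 1)
  have hXY : X + Y ≤ q := by
    have e1 := cosStep_sub (n := n) (2 * k + 1) 1
    have e2 := sinStep_sub (n := n) (2 * k + 1) 1
    have e3 := cosStep_add (n := n) (2 * k + 1) 1
    have e4 := sinStep_add (n := n) (2 * k + 1) 1
    rw [add_sub_cancel_right] at e1 e2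
    rw [show 2 * k + 1 + 1 = 2 * (k + 1) by ring] at e3 e4
    rw [vecFunctional_vertex, hx0, hx1,
      show 2 * (k + m + 1) = (2 * k + 1) + (n : ℤ) by rw [hn]; push_cast; ring,
      cosStep_add_self hn0, sinStep_add_self hn0, e1, e2, e3, e4] at hv
    have : X + Y = (X + Y) * (polyR n * cosStep n 1)
        * (cosStep n (2 * k + 1) ^ 2 + sinStep n (2 * k + 1) ^ 2) := by
      rw [hu, polyR_mul hm hn]; ring
    rw [this]
    linarith
  have hsum : vecFunctional w q = X • ray n k + Y • ray n (k + 1)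
      + (q - X - Y) • vecFunctional 0 1 := by
    refine LinearMap.ext fun s => ?_
    simp only [LinearMap.add_apply, LinearMap.smul_apply, ray, vecFunctional_apply, smul_eq_mul,
      Matrix.cons_val_zero, Matrix.cons_val_one, Pi.zero_apply]
    rw [hx0, hx1]
    ring
  rw [hsum]
  exact M.add_mem (M.add_mem (hsmul _ _ hX (hray _)) (hsmul _ _ hY (hray _)))
    (hsmul _ _ (by linarith) hunit)

/-- The direction of a ray of the effect cone. -/
noncomputable def rayDir (n : ℕ) (i : ℤ) : ℝ × ℝ := (cosStep n (2 * i), sinStep n (2 * i))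

theorem cross_rayDir (i j : ℤ) : cross (rayDir n i) (rayDir n j) = sinStep n (2 * (j - i)) := by
  rw [mul_sub, sinStep_sub]; simp only [cross, rayDir]; ring

/-- The chord of the polygon from `i` to `j`, with the origin strictly on its left, is at least as
far from the origin as the longest diagonals, so that the points cut out by the longest diagonals
lie on its left. -/
theorem edge_nonneg (hn : n = 2 * m + 1) {q : ℝ} {w : ℝ × ℝ} (hq : 0 ≤ q)
    (h : ∀ c : ℤ, cosStep n (2 * c - m) * w.1 + sinStep n (2 * c - m) * w.2 ≤ q * cosStep n m)
    (i j : ℤ) (hij : 0 < cross (rayDir n i) (rayDir n j)) :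
    0 ≤ q * cross (rayDir n i) (rayDir n j) - cross w (rayDir n j - rayDir n i) := by
  have hn0 : n ≠ 0 := by omega
  have hn' : (0 : ℤ) < n := by omega
  have h1 := Int.emod_nonneg (j - i) hn'.ne'
  have h2 := Int.emod_lt_of_pos (j - i) hn'
  have h3 := Int.emod_add_mul_ediv (j - i) n
  set l := (j - i) % n
  obtain ⟨z, hz⟩ : ∃ z, j = i + l + n * z := ⟨(j - i) / n, by linarith⟩
  have hj : rayDir n j = rayDir n (i + l) := by
    simp only [rayDir, hz, mul_add _ (i + l), cosStep_add_period hn0, sinStep_add_period hn0]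
  rw [hj, cross_rayDir, add_sub_cancel_left] at hij ⊢
  obtain ⟨hl0, hl⟩ := pos_lt_of_sinStep_pos hn0 (by omega) (by omega) hij
  have hc := component_le_of_parity hn hq h i (l := l) (by omega) (by omega)
  have hs := sinStep_nonneg (n := n) (t := l) h1 h2.le
  have e1 : cosStep n (2 * (i + l)) = cosStep n (2 * i + l) * cosStep n l
      - sinStep n (2 * i + l) * sinStep n l := by
    rw [← cosStep_add]; congr 1; ring
  have e2 : sinStep n (2 * (i + l)) = sinStep n (2 * i + l) * cosStep n l
      + cosStep n (2 * i + l) * sinStep n l := by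
    rw [← sinStep_add]; congr 1; ring
  have e3 : cosStep n (2 * i) = cosStep n (2 * i + l) * cosStep n l
      + sinStep n (2 * i + l) * sinStep n l := by
    rw [← cosStep_sub]; congr 1; ring
  have e4 : sinStep n (2 * i) = sinStep n (2 * i + l) * cosStep n l
      - cosStep n (2 * i + l) * sinStep n l := by
    rw [← sinStep_sub]; congr 1; ring
  have e5 : sinStep n (2 * l) = 2 * sinStep n l * cosStep n l := by
    rw [two_mul, sinStep_add]; ring
  simp only [cross, rayDir, Prod.fst_sub, Prod.snd_sub, e1, e2, e3, e4, e5]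
  linarith [mul_nonneg hs (sub_nonneg.2 hc)]

/-- The rays into which the effects of an arbitrary `B` decompose refine `B`, and `A` is obtained
from the same refinement by transport. -/
theorem mem_T3_of_component_le (hm : 1 ≤ m) (hn : n = 2 * m + 1) {Ω : Type*} [Fintype Ω]
    {A : Observable (polygon n) Ω} {w : Ω → Fin 2 → ℝ} {q : Ω → ℝ} (hq : ∀ x, 0 ≤ q x)
    (hA : ∀ x, A.effect x = vecFunctional (w x) (q x))
    (h : ∀ x, ∀ c : ℤ, cosStep n (2 * c - m) * w x 0 + sinStep n (2 * c - m) * w x 1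
      ≤ q x * cosStep n m) :
    A ∈ T3 (polygon n) Ω := by
  intro Ω' _ B
  have hn0 : n ≠ 0 := by omega
  have hdec : ∀ y, ∃ c : Fin n → ℝ≥0, ∑ k, c k • ray n (k : ℕ) = B.effect y := fun y =>
    Submodule.mem_span_range_iff_exists_fun ℝ≥0 |>.1 <| mem_span_rays hm hn fun j =>
      (B.mem_effects y _ (vertex_mem_polygon hn0 j)).1
  choose b hb using hdec
  have hb' : ∀ y, B.effect y = ∑ k : Fin n, (b y k : ℝ) • ray n (k : ℕ) := fun y => (hb y).symm
  let β : Fin n → ℝ := fun k => ∑ y, (b y k : ℝ)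
  have hβ : ∀ k, 0 ≤ β k := fun k => Finset.sum_nonneg fun y _ => (b y k).2
  have hunit : ∑ k : Fin n, β k • ray n (k : ℕ) = vecFunctional 0 1 := by
    refine ext_on_polygon hm hn fun s hs => ?_
    trans 1
    swap
    · simp [vecFunctional_apply, third_of_mem_polygon hs]
    rw [← B.sum_eq_one s hs]
    simp only [hb', β, LinearMap.sum_apply, LinearMap.smul_apply, Finset.sum_smul]
    rw [Finset.sum_comm]
  have hAunit : ∑ x, vecFunctional (w x) (q x) = vecFunctional 0 1 := by
    refine ext_on_polygon hm hn fun s hs => ?_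
    trans 1
    swap
    · simp [vecFunctional_apply, third_of_mem_polygon hs]
    rw [← A.sum_eq_one s hs]
    simp only [hA, LinearMap.sum_apply]
  -- Equations between functionals are compared on the standard basis.
  have hβ1 : ∑ k, β k = 1 := by
    simpa [ray, vecFunctional_apply] using LinearMap.congr_fun hunit ![0, 0, 1]
  have hβu : ∑ k : Fin n, β k • rayDir n (k : ℕ) = 0 := by
    ext
    · simpa [Prod.fst_sum, ray, rayDir, vecFunctional_apply] using
        LinearMap.congr_fun hunit ![1, 0, 0]
    · simpa [Prod.snd_sum, ray, rayDir, vecFunctional_apply] using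
        LinearMap.congr_fun hunit ![0, 1, 0]
  have hq1 : ∑ x, q x = 1 := by
    simpa [vecFunctional_apply] using LinearMap.congr_fun hAunit ![0, 0, 1]
  have hw0 : ∑ x, ((w x 0, w x 1) : ℝ × ℝ) = 0 := by
    ext
    · simpa [Prod.fst_sum, vecFunctional_apply] using LinearMap.congr_fun hAunit ![1, 0, 0]
    · simpa [Prod.snd_sum, vecFunctional_apply] using LinearMap.congr_fun hAunit ![0, 1, 0]
  have hu : ∀ i j : Fin n, cross (rayDir n (i : ℕ)) (rayDir n (j : ℕ)) = 0 → i = j := by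
    intro i j hij
    rw [cross_rayDir] at hij
    have hdvd : (n : ℤ) ∣ ((j : ℕ) : ℤ) - ((i : ℕ) : ℤ) := by
      by_contra hnd
      exact sinStep_two_mul_ne_zero ⟨m, hn⟩ hnd hij
    have := Int.eq_zero_of_abs_lt_dvd hdvd (abs_lt.2 ⟨by omega, by omega⟩)
    exact Fin.ext (by omega)
  have hu0 : ∀ i : Fin n, rayDir n (i : ℕ) ≠ 0 := by
    intro i hi
    have h1 := cosStep_sq_add_sinStep_sq (n := n) (2 * (i : ℕ))
    have h2 := congrArg Prod.fst hi
    have h3 := congrArg Prod.snd hi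
    simp only [rayDir, Prod.fst_zero, Prod.snd_zero] at h2 h3
    rw [h2, h3] at h1
    norm_num at h1
  obtain ⟨c, hc0, hc1, hc2, hc3⟩ := hasTransport_of_balanced (u := fun k : Fin n => rayDir n (k : ℕ))
    (q := q) (w := fun x => (w x 0, w x 1)) hq1 hw0
    (fun i j hij x => edge_nonneg hn (hq x) (h x) _ _ hij) hu hu0
    hβ hβu
  have hAc : ∀ x, A.effect x = ∑ k : Fin n, c x k • ray n (k : ℕ) := by
    intro x
    have h1 := hc1 x
    have h2 := congrArg Prod.fst (hc2 x)
    have h3 := congrArg Prod.snd (hc2 x)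
    rw [hβ1, one_mul] at h1
    rw [hβ1, one_smul] at h2 h3
    simp only [Prod.fst_sum, Prod.snd_sum, Prod.smul_fst, Prod.smul_snd, rayDir,
      smul_eq_mul] at h2 h3
    refine LinearMap.ext fun s => ?_
    rw [hA, vecFunctional_apply, ← h1, ← h2, ← h3]
    simp only [LinearMap.sum_apply, LinearMap.smul_apply, ray, vecFunctional_apply,
      Matrix.cons_val_zero, Matrix.cons_val_one, smul_eq_mul, Finset.sum_mul,
      ← Finset.sum_add_distrib]
    exact Finset.sum_congr rfl fun k _ => by ring
  let J : Observable (polygon n) (Fin n) := Observable.ofNonneg (fun k => β k • ray n (k : ℕ))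
    (fun k s hs => mul_nonneg (hβ k) (ray_nonneg hm hn _ s hs)) fun s hs => by
      rw [← LinearMap.sum_apply, hunit, vecFunctional_apply, third_of_mem_polygon hs]; simp
  exact ⟨Fin n, inferInstance, J,
    postProcesses_of_combination (vertex_mem_polygon hn0 0) (fun k => rfl) hc0 hc3 hAc,
    postProcesses_of_combination (vertex_mem_polygon hn0 0) (fun k => rfl)
      (fun y k => (b y k).2) (fun k => rfl) hb'⟩

end Sufficiency

/-! ### The gauges -/

section Gauges

variable {n m : ℕ}

/-- A supremum over `k ∈ {1, …, n}` of a function of period `n` on the integers. -/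
theorem iSup_Icc_le_iff (hn : n ≠ 0) {f : ℤ → ℝ} (hf : ∀ j z : ℤ, f (j + n * z) = f j) {C : ℝ} :
    (⨆ k : Set.Icc 1 n, f (k : ℕ)) ≤ C ↔ ∀ j, f j ≤ C := by
  have : Nonempty (Set.Icc 1 n) := ⟨⟨1, le_rfl, by omega⟩⟩
  rw [ciSup_le_iff (Set.finite_range _).bddAbove]
  refine ⟨fun h j => ?_, fun h k => h _⟩
  obtain ⟨k, hk, z, rfl⟩ := exists_mem_Icc_add_mul hn j
  rw [hf]
  exact h ⟨k, hk⟩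

theorem etaE_le_iff (hn : n ≠ 0) {a : Fin 2 → ℝ} {C : ℝ} : etaE n a ≤ C ↔
    ∀ j : ℤ, polyR n * (cosStep n (2 * j) * a 0 + sinStep n (2 * j) * a 1) ≤ C := by
  rw [← iSup_Icc_le_iff hn (f := fun j => polyR n * (cosStep n (2 * j) * a 0 + sinStep n (2 * j) * a 1))
    fun j z => by simp only [mul_add 2 j, cosStep_add_period hn, sinStep_add_period hn], etaE]
  simp only [cosStep, sinStep]
  push_cast
  simp only [mul_right_comm]

theorem etaO_le_iff (hn : n ≠ 0) {a : Fin 2 → ℝ} {C : ℝ} : etaO n a ≤ C ↔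
    ∀ j : ℤ, polyR n * (cosStep n (2 * j - 1) * a 0 + sinStep n (2 * j - 1) * a 1) ≤ C := by
  rw [← iSup_Icc_le_iff hn
    (f := fun j => polyR n * (cosStep n (2 * j - 1) * a 0 + sinStep n (2 * j - 1) * a 1))
    fun j z => by
      simp only [mul_add 2 j, add_sub_right_comm, cosStep_add_period hn, sinStep_add_period hn],
    etaO]
  simp only [cosStep, sinStep]
  push_cast
  rfl

/-- Membership in `T3` in terms of the directions normal to the longest diagonals. -/
theorem mem_T3_iff_component_le (hm : 1 ≤ m) (hn : n = 2 * m + 1) {Ω : Type*} [Fintype Ω]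
    {A : Observable (polygon n) Ω} {α : Ω → ℝ} {a : Ω → Fin 2 → ℝ}
    (hA : ∀ x, A.effect x = α x • vecFunctional (a x) (polySigma n)) :
    A ∈ T3 (polygon n) Ω ↔ ∀ x, α x ≠ 0 → ∀ c : ℤ,
      polyR n * (cosStep n (2 * c - m) * a x 0 + sinStep n (2 * c - m) * a x 1)
        ≤ polySigma n * polyR n * Real.sin (Real.pi / (2 * n)) := by
  have hn0 : n ≠ 0 := by omega
  have hσ := polySigma_pos hm hn
  have hr := polyR_pos hm hn
  have hA' : ∀ x, A.effect x = vecFunctional (α x • a x) (α x * polySigma n) := by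
    intro x
    rw [hA]
    refine LinearMap.ext fun s => ?_
    simp only [LinearMap.smul_apply, vecFunctional_apply, Pi.smul_apply, smul_eq_mul]
    ring
  -- On the rays, and hence on all effects, the third coordinate is nonnegative.
  have hα : ∀ x, 0 ≤ α x := by
    intro x
    obtain ⟨c, hc⟩ := (Submodule.mem_span_range_iff_exists_fun ℝ≥0).1 <|
      mem_span_rays hm hn fun j => (A.mem_effects x _ (vertex_mem_polygon hn0 j)).1
    have h := LinearMap.congr_fun hc ![0, 0, 1]
    rw [hA', LinearMap.sum_apply] at h
    simp [ray, vecFunctional_apply, NNReal.smul_def] at h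
    refine nonneg_of_mul_nonneg_left ?_ hσ
    rw [← h]
    positivity
  have hiff : ∀ x (c : ℤ), α x ≠ 0 →
      (polyR n * (cosStep n (2 * c - m) * a x 0 + sinStep n (2 * c - m) * a x 1)
        ≤ polySigma n * polyR n * Real.sin (Real.pi / (2 * n)) ↔
      cosStep n (2 * c - m) * (α x • a x) 0 + sinStep n (2 * c - m) * (α x • a x) 1
        ≤ α x * polySigma n * cosStep n m) := by
    intro x c hx
    have hpos : 0 < α x := lt_of_le_of_ne (hα x) (Ne.symm hx)
    rw [← cosStep_half hn, mul_comm (polySigma n), mul_assoc, mul_le_mul_iff_right₀ hr,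
      ← mul_le_mul_iff_right₀ hpos]
    simp only [Pi.smul_apply, smul_eq_mul]
    ring_nf
  constructor
  · intro h x hx c
    exact (hiff x c hx).2 (component_le_of_mem_T3 hm hn h (hA' x) c)
  · intro h
    refine mem_T3_of_component_le hm hn (fun x => mul_nonneg (hα x) hσ.le) hA' fun x c => ?_
    by_cases hx : α x = 0
    · simp [hx]
    · exact (hiff x c hx).1 (h x hx c)

end Gauges

end GPT

theorem mainTheorem6 (m n : ℕ) (hm : 1 ≤ m) (hn : n = 2 * m + 1)
    {Ω : Type*} [Fintype Ω] (A : GPT.Observable (GPT.polygon n) Ω)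
    (α : Ω → ℝ) (a : Ω → Fin 2 → ℝ)
    (hA : ∀ x, A.effect x = α x • GPT.vecFunctional (a x) (GPT.polySigma n)) :
    (Even m →
      (A ∈ GPT.T3 (GPT.polygon n) Ω ↔
        ∀ x, α x ≠ 0 →
          GPT.etaE n (a x) ≤ GPT.polySigma n * GPT.polyR n * Real.sin (Real.pi / (2 * n)))) ∧
    (Odd m →
      (A ∈ GPT.T3 (GPT.polygon n) Ω ↔
        ∀ x, α x ≠ 0 →
          GPT.etaO n (a x) ≤ GPT.polySigma n * GPT.polyR n * Real.sin (Real.pi / (2 * n)))) := by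
  have hn0 : n ≠ 0 := by omega
  rw [GPT.mem_T3_iff_component_le hm hn hA]
  -- The integers `2 c - m` are the even or the odd ones, according to the parity of `m`.
  constructor
  · rintro ⟨d, hd⟩
    simp only [GPT.etaE_le_iff hn0]
    refine forall₂_congr fun x _ => ⟨fun h j => ?_, fun h c => ?_⟩
    · have := h (j + d)
      rwa [show 2 * (j + d) - (m : ℤ) = 2 * j by rw [hd]; push_cast; ring] at this
    · have := h (c - d)
      rwa [show 2 * (c - d) = 2 * c - (m : ℤ) by rw [hd]; push_cast; ring] at this
  · rintro ⟨d, hd⟩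
    simp only [GPT.etaO_le_iff hn0]
    refine forall₂_congr fun x _ => ⟨fun h j => ?_, fun h c => ?_⟩
    · have := h (j + d)
      rwa [show 2 * (j + d) - (m : ℤ) = 2 * j - 1 by rw [hd]; push_cast; ring] at this
    · have := h (c - d)
      rwa [show 2 * (c - d) - 1 = 2 * c - (m : ℤ) by rw [hd]; push_cast; ring] at this
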